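/- Let $N\ge 1$ and $M\ge 0$ be integers, let $k_1<k_2<\dots<k_M$ be positive integers with $k_M<N$ (no condition if $M=0$), and put $\Lambda=\{0,\dots,N\}\setminus\{k_1,\dots,k_M\}$. Let $\mathcal P(\Lambda)$ be the space of polynomials $\sum_{k\in\Lambda}c_kz^k$ with complex coefficients, normed by $\|p\|_1=\frac1{2\pi}\int_0^{2\pi}|p(e^{i\theta})|\,d\theta$, and let $\mathrm{ball}(\mathcal P(\Lambda))=\{q\in\mathcal P(\Lambda):\|q\|_1\le 1\}$. Let $p(z)=\sum_{k=0}^N c_kz^k\in\mathcal P(\Lambda)$ with $\|p\|_1=1$, and put $p^*(z)=\sum_{k=0}^N\overline{c_k}\,z^{N-k}$, so that $p^*(z)=z^N\overline{p(1/\bar z)}$ for $z\ne0$. Let $a_1,\dots,a_n$ be the distinct common zeros of $p$ and $p^*$ in the open unit disc $\{|z|<1\}$, let $m_j$ be the minimum of the multiplicities of $a_j$ as a zero of $p$ and as a zero of $p^*$, and put $m=\sum_{j=1}^n m_j$. The polynomial $$G(z)=\prod_{j=1}^n(z-a_j)^{m_j}(1-\overline{a_j}z)^{m_j}$$ divides $p$;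 let $R=p/G$, let $C_k$ be the coefficient of $z^k$ in the polynomial $R$ for integers $k\ge0$, and let $C_k=0$ for integers $k<0$. Write $A(k)=\operatorname{Re}C_k$ and $B(k)=\operatorname{Im}C_k$ for $k\in\mathbb Z$, and for $1\le j\le M$, $0\le l\le m$ put $$A^{\pm}_{j,l}=A(k_j+l-m)\pm A(k_j-l-m),\qquad B^{\pm}_{j,l}=B(k_j+l-m)\pm B(k_j-l-m).$$ Let $\mathcal A^+=(A^+_{j,l})$ and $\mathcal B^+=(B^+_{j,l})$ be the $M\times(m+1)$ matrices with $1\le j\le M$, $0\le l\le m$, let $\mathcal A^-=(A^-_{j,l})$ and $\mathcal B^-=(B^-_{j,l})$ be the $M\times m$ matrices with $1\le j\le M$, $1\le l\le m$, and let $$\mathfrak M=\begin{pmatrix}\mathcal A^+&\mathcal B^-\\ \mathcal B^+&-\mathcal A^-\end{pmatrix},$$ a real matrix with $2M$ rows and $2m+1$ columns. Then $p$ is an extreme point of $\mathrm{ball}(\mathcal P(\Lambda))$ if and only if $\operatorname{rank}\mathfrak M=2m$. -/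

import Mathlib

open Polynomial

noncomputable section

namespace Lacunary

/-- The frequency set `{0, …, N} \ {k₁, …, k_M}`. -/
def freqSet (N : ℕ) {M : ℕ} (k : Fin M → ℕ) : Finset ℕ :=
  Finset.range (N + 1) \ Finset.univ.image k

/-- The space of polynomials `∑_{k ∈ Λ} c_k z^k` with complex coefficients. -/
def polySpace (Λ : Finset ℕ) : Submodule ℂ ℂ[X] where
  carrier := {p | ∀ k, k ∉ Λ → p.coeff k = 0}
  add_mem' := fun {p q} hp hq k hk => by simp [hp k hk, hq k hk]
  zero_mem' := fun k _ => by simp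
  smul_mem' := fun c p hp k hk => by simp [hp k hk]

/-- The norm `(1/2π) ∫_𝕋 |p(ζ)| |dζ|`. -/
def l1Norm (p : ℂ[X]) : ℝ := Real.circleAverage (fun z => ‖p.eval z‖) 0 1

/-- The closed unit ball of `polySpace Λ` with respect to `l1Norm`. -/
def ball (Λ : Finset ℕ) : Set ℂ[X] := {p | p ∈ polySpace Λ ∧ l1Norm p ≤ 1}

/-- `p*(z) = ∑_{k ≤ N} conj(c_k) z^(N-k)` where `p(z) = ∑_{k ≤ N} c_k z^k`. -/
def pstar (N : ℕ) (p : ℂ[X]) : ℂ[X] := (p.map (starRingEnd ℂ)).reflect N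

/-- The distinct common zeros of `p` and `p*` in the open unit disc (for `p ≠ 0`). -/
def commonZeros (N : ℕ) (p : ℂ[X]) : Finset ℂ :=
  (p.roots.toFinset ∩ (pstar N p).roots.toFinset).filter fun a => ‖a‖ < 1

/-- The common multiplicity `min {mult(a, p), mult(a, p*)}`. -/
def commonMult (N : ℕ) (p : ℂ[X]) (a : ℂ) : ℕ :=
  min (p.rootMultiplicity a) ((pstar N p).rootMultiplicity a)

/-- The total multiplicity `m` of the common zeros of `p` and `p*` in the disc. -/
def totalMult (N : ℕ) (p : ℂ[X]) : ℕ := ∑ a ∈ commonZeros N p, commonMult N p a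

/-- `G(z) = ∏_j (z - a_j)^{m_j} (1 - conj(a_j) z)^{m_j}`. -/
def factorG (N : ℕ) (p : ℂ[X]) : ℂ[X] :=
  ∏ a ∈ commonZeros N p,
    (X - C a) ^ commonMult N p a * (1 - C (starRingEnd ℂ a) * X) ^ commonMult N p a

/-- The quotient `R = p / G`; the division is exact for nonzero `p` of degree at most `N`. -/
def factorR (N : ℕ) (p : ℂ[X]) : ℂ[X] := p / factorG N p

/-- The coefficient `C_k` of `R`, for any integer `k` (zero for negative `k`). -/
def intCoeff (R : ℂ[X]) (k : ℤ) : ℂ := if 0 ≤ k then R.coeff k.toNat else 0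

/-- `A(k_j + l - m) + A(k_j - l - m)`, where `A(k) = Re C_k` and `0 ≤ l ≤ m`. -/
def matAPlus (R : ℂ[X]) (m : ℕ) {M : ℕ} (k : Fin M → ℕ) : Matrix (Fin M) (Fin (m + 1)) ℝ :=
  Matrix.of fun j l =>
    (intCoeff R ((k j : ℤ) + (l : ℕ) - m)).re + (intCoeff R ((k j : ℤ) - (l : ℕ) - m)).re

/-- `B(k_j + l - m) + B(k_j - l - m)`, where `B(k) = Im C_k` and `0 ≤ l ≤ m`. -/
def matBPlus (R : ℂ[X]) (m : ℕ) {M : ℕ} (k : Fin M → ℕ) : Matrix (Fin M) (Fin (m + 1)) ℝ :=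
  Matrix.of fun j l =>
    (intCoeff R ((k j : ℤ) + (l : ℕ) - m)).im + (intCoeff R ((k j : ℤ) - (l : ℕ) - m)).im

/-- `A(k_j + l - m) - A(k_j - l - m)` for `1 ≤ l ≤ m`; column `i : Fin m` stands for
`l = i + 1`. -/
def matAMinus (R : ℂ[X]) (m : ℕ) {M : ℕ} (k : Fin M → ℕ) : Matrix (Fin M) (Fin m) ℝ :=
  Matrix.of fun j i =>
    (intCoeff R ((k j : ℤ) + ((i : ℕ) + 1) - m)).re
      - (intCoeff R ((k j : ℤ) - ((i : ℕ) + 1) - m)).re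

/-- `B(k_j + l - m) - B(k_j - l - m)` for `1 ≤ l ≤ m`; column `i : Fin m` stands for
`l = i + 1`. -/
def matBMinus (R : ℂ[X]) (m : ℕ) {M : ℕ} (k : Fin M → ℕ) : Matrix (Fin M) (Fin m) ℝ :=
  Matrix.of fun j i =>
    (intCoeff R ((k j : ℤ) + ((i : ℕ) + 1) - m)).im
      - (intCoeff R ((k j : ℤ) - ((i : ℕ) + 1) - m)).im

/-- The real block matrix with `2M` rows and `2m + 1` columns attached to `p`. -/
def blockMatrix (N : ℕ) {M : ℕ} (k : Fin M → ℕ) (p : ℂ[X]) :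
    Matrix (Fin M ⊕ Fin M) (Fin (totalMult N p + 1) ⊕ Fin (totalMult N p)) ℝ :=
  Matrix.fromBlocks
    (matAPlus (factorR N p) (totalMult N p) k) (matBMinus (factorR N p) (totalMult N p) k)
    (matBPlus (factorR N p) (totalMult N p) k) (-matAMinus (factorR N p) (totalMult N p) k)

end Lacunary

end

/-! Suppose `p = a x₁ + b x₂` is a proper convex combination inside the ball. Integrating the
triangle inequality forces `|p| = |a x₁| + |b x₂|` on the whole circle, so `x₁ / p` is real where `p
≠ 0` and `|x₁| ≤ |p| / a`. Realness amounts to `x₁ p* = p x₁*`. Since `p = G R` and `p* = G R*`,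
with `R*` reflected in degree `N - 2m`, it follows that `x₁ R* = R x₁*`. Off the circle `R` and `R*`
share no zero; on the circle `x₁` inherits the zeros of `R`. Hence `x₁ = S R` with `S`
self-reciprocal of degree at most `2m` (`exists_eq_mul_factorR`).

Conversely, on the circle `S / z^m` is real and `G / z^m = |G| > 0`, so the norm of `(G + εS)R` is
affine in small `ε` (`l1Norm_perturb`). Subtracting a multiple of `G` from `S` makes the slope
vanish, and then `p` is the midpoint of `p ± εSR`. So `p` is extreme exactly when the admissible `S`
are the real multiples of `G` (`mem_extremePoints_iff_forall_eq_smul`).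

The self-reciprocal `S` form a real space of dimension `2m + 1`. In suitable coordinates the block
matrix sends `S` to the real and imaginary parts of the coefficients of `S R` at the `k_j`. Its
kernel contains the nonzero vector of `G`, so rank `2m` means that `G` spans the kernel. -/

namespace Lacunary

/-! ### Reflection of polynomials -/

lemma pstar_pstar (n : ℕ) (f : ℂ[X]) : pstar n (pstar n f) = f := by
  simp [pstar, reflect_map, Polynomial.map_map]

lemma pstar_mul {a b : ℕ} {f g : ℂ[X]} (hf : f.natDegree ≤ a) (hg : g.natDegree ≤ b) :
    pstar (a + b) (f * g) = pstar a f * pstar b g := by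
  unfold pstar
  rw [Polynomial.map_mul, reflect_mul]
  · exact natDegree_map_le.trans hf
  · exact natDegree_map_le.trans hg

lemma natDegree_pstar_le {n : ℕ} {f : ℂ[X]} (hf : f.natDegree ≤ n) :
    (pstar n f).natDegree ≤ n :=
  natDegree_reflect_le.trans (max_le le_rfl (natDegree_map_le.trans hf))

lemma coeff_pstar {n i : ℕ} (f : ℂ[X]) (hi : i ≤ n) :
    (pstar n f).coeff i = starRingEnd ℂ (f.coeff (n - i)) := by
  simp [pstar, coeff_reflect, revAt_le hi]

lemma pstar_ne_zero {n : ℕ} {f : ℂ[X]} (hf : f ≠ 0) : pstar n f ≠ 0 := by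
  intro h
  apply hf
  rw [← pstar_pstar n f, h]
  simp [pstar]

lemma pstar_pow {a : ℕ} {f : ℂ[X]} (hf : f.natDegree ≤ a) (j : ℕ) :
    pstar (a * j) (f ^ j) = pstar a f ^ j := by
  induction j with
  | zero => simp [pstar]
  | succ j ih =>
    rw [pow_succ, mul_add, mul_one, pstar_mul _ hf, ih, pow_succ]
    rw [mul_comm]
    exact natDegree_pow_le_of_le j hf

lemma pstar_prod {ι : Type*} (s : Finset ι) (d : ι → ℕ) (f : ι → ℂ[X])
    (hf : ∀ i ∈ s, (f i).natDegree ≤ d i) :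
    pstar (∑ i ∈ s, d i) (∏ i ∈ s, f i) = ∏ i ∈ s, pstar (d i) (f i) := by
  classical
  induction s using Finset.induction_on with
  | empty => simp [pstar]
  | insert i s hi ih =>
    rw [Finset.sum_insert hi, Finset.prod_insert hi, Finset.prod_insert hi, pstar_mul, ih]
    · exact fun j hj => hf j (Finset.mem_insert_of_mem hj)
    · exact hf i (Finset.mem_insert_self _ _)
    · exact (natDegree_prod_le _ _).trans
        (Finset.sum_le_sum fun j hj => hf j (Finset.mem_insert_of_mem hj))

lemma pstar_X_sub_C (a : ℂ) : pstar 1 (X - C a) = 1 - C (starRingEnd ℂ a) * X := by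
  simp [pstar, reflect_sub, reflect_C]

lemma natDegree_one_sub_C_mul_X_le (a : ℂ) : (1 - C a * X : ℂ[X]).natDegree ≤ 1 := by
  compute_degree

lemma pstar_one_sub_C_mul_X (a : ℂ) :
    pstar 1 (1 - C (starRingEnd ℂ a) * X) = X - C a := by
  rw [← pstar_X_sub_C, pstar_pstar]

lemma one_sub_C_mul_X_ne_zero (a : ℂ) : (1 - C a * X : ℂ[X]) ≠ 0 := by
  intro h
  simpa using congrArg (eval 0) h

/-- The reflection formula `f*(z) = z ^ n * conj (f (1 / conj z))`. -/
lemma eval_pstar {n : ℕ} {f : ℂ[X]} (hf : f.natDegree ≤ n) {z : ℂ} (hz : z ≠ 0) :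
    (pstar n f).eval z = z ^ n * starRingEnd ℂ (f.eval (starRingEnd ℂ z)⁻¹) := by
  let _ : Invertible z⁻¹ := invertibleOfNonzero (inv_ne_zero hz)
  have h := eval₂_reflect_mul_pow (RingHom.id ℂ) z⁻¹ n (f.map (starRingEnd ℂ))
    (natDegree_map_le.trans hf)
  simp only [invOf_eq_inv, inv_inv] at h
  have h2 : starRingEnd ℂ (f.eval (starRingEnd ℂ z)⁻¹) = (f.map (starRingEnd ℂ)).eval z⁻¹ := by
    rw [eval_map, ← eval₂_at_apply, map_inv₀, Complex.conj_conj]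
  rw [h2, eval, eval, ← h, pstar]
  rw [inv_pow]
  field_simp

lemma eval_pstar_of_norm_eq_one {n : ℕ} {f : ℂ[X]} (hf : f.natDegree ≤ n) {z : ℂ}
    (hz : ‖z‖ = 1) : (pstar n f).eval z = z ^ n * starRingEnd ℂ (f.eval z) := by
  have h0 : z ≠ 0 := by rintro rfl; simp at hz
  rw [eval_pstar hf h0]
  congr 3
  rw [inv_eq_iff_eq_inv, Complex.inv_def, Complex.normSq_eq_norm_sq, hz]
  simp

/-- Divisibility is preserved by reflection. -/
lemma pstar_dvd_pstar {n : ℕ} {f g : ℂ[X]} (hg0 : g ≠ 0) (hg : g.natDegree ≤ n) (h : f ∣ g) :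
    pstar f.natDegree f ∣ pstar n g := by
  obtain ⟨u, rfl⟩ := h
  have hf0 : f ≠ 0 := left_ne_zero_of_mul hg0
  have hu0 : u ≠ 0 := right_ne_zero_of_mul hg0
  rw [natDegree_mul hf0 hu0] at hg
  obtain ⟨d, rfl⟩ := Nat.exists_eq_add_of_le (show f.natDegree ≤ n by omega)
  rw [pstar_mul le_rfl (by omega)]
  exact dvd_mul_right _ _

/-! ### The factorisations `p = G R` and `p* = G R*` -/

section factor

variable {N : ℕ} {p : ℂ[X]}

lemma mem_commonZeros (hp0 : p ≠ 0) {a : ℂ} :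
    a ∈ commonZeros N p ↔ p.eval a = 0 ∧ (pstar N p).eval a = 0 ∧ ‖a‖ < 1 := by
  simp [commonZeros, hp0, pstar_ne_zero hp0, and_assoc]

lemma norm_lt_one_of_mem_commonZeros {a : ℂ} (ha : a ∈ commonZeros N p) : ‖a‖ < 1 := by
  simp only [commonZeros, Finset.mem_filter] at ha
  exact ha.2

lemma X_sub_C_pow_dvd (a : ℂ) : (X - C a) ^ commonMult N p a ∣ p :=
  (pow_dvd_pow _ (min_le_left _ _)).trans (pow_rootMultiplicity_dvd p a)

lemma X_sub_C_pow_dvd_pstar (a : ℂ) : (X - C a) ^ commonMult N p a ∣ pstar N p :=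
  (pow_dvd_pow _ (min_le_right _ _)).trans (pow_rootMultiplicity_dvd _ a)

lemma one_sub_C_mul_X_pow_dvd (hp0 : p ≠ 0) (hp : p.natDegree ≤ N) (a : ℂ) :
    (1 - C (starRingEnd ℂ a) * X) ^ commonMult N p a ∣ p := by
  have h := pstar_dvd_pstar (pstar_ne_zero hp0) (natDegree_pstar_le hp)
    (X_sub_C_pow_dvd_pstar (N := N) (p := p) a)
  rw [pstar_pstar, natDegree_pow, natDegree_X_sub_C, mul_one] at h
  have h2 := pstar_pow (natDegree_X_sub_C a).le (commonMult N p a)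
  rw [one_mul] at h2
  rwa [h2, pstar_X_sub_C] at h

lemma isCoprime_of_comb {f g u v : ℂ[X]} {c : ℂ} (hc : c ≠ 0) (h : u * f + v * g = C c) :
    IsCoprime f g := by
  refine ⟨C c⁻¹ * u, C c⁻¹ * v, ?_⟩
  rw [mul_assoc, mul_assoc, ← mul_add, h, ← C_mul, inv_mul_cancel₀ hc, C_1]

lemma one_sub_conj_mul_ne_zero {a b : ℂ} (ha : ‖a‖ < 1) (hb : ‖b‖ < 1) :
    1 - starRingEnd ℂ b * a ≠ 0 := by
  intro h
  have h1 : ‖starRingEnd ℂ b * a‖ = 1 := by rw [← sub_eq_zero.1 h]; simp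
  rw [norm_mul, RCLike.norm_conj] at h1
  nlinarith [norm_nonneg a, norm_nonneg b]

lemma isCoprime_X_sub_C_one_sub {a b : ℂ} (ha : ‖a‖ < 1) (hb : ‖b‖ < 1) :
    IsCoprime (X - C a) (1 - C (starRingEnd ℂ b) * X) := by
  refine isCoprime_of_comb (one_sub_conj_mul_ne_zero ha hb) (u := C (starRingEnd ℂ b)) (v := 1) ?_
  simp only [C_sub, C_mul, C_1]
  ring

lemma isCoprime_one_sub_one_sub {a b : ℂ} (hab : a ≠ b) :
    IsCoprime (1 - C (starRingEnd ℂ a) * X) (1 - C (starRingEnd ℂ b) * X) := by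
  have hc : starRingEnd ℂ b - starRingEnd ℂ a ≠ 0 := by
    rw [sub_ne_zero]
    exact fun h => hab ((starRingEnd ℂ).injective h).symm
  refine isCoprime_of_comb hc (u := C (starRingEnd ℂ b)) (v := -C (starRingEnd ℂ a)) ?_
  simp only [C_sub]
  ring

/-- The factors are pairwise coprime: the points `a` lie inside the disc, the reflected points
outside, and each family is distinct. For `a = 0` the reflected factor is the constant `1`. -/
lemma factorG_dvd (hp0 : p ≠ 0) (hp : p.natDegree ≤ N) : factorG N p ∣ p := by
  refine Finset.prod_dvd_of_coprime ?_ ?_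
  · intro a ha b hb hab
    have ha' := norm_lt_one_of_mem_commonZeros (Finset.mem_coe.1 ha)
    have hb' := norm_lt_one_of_mem_commonZeros (Finset.mem_coe.1 hb)
    refine IsCoprime.mul_left (IsCoprime.mul_right ?_ ?_) (IsCoprime.mul_right ?_ ?_)
    · exact (isCoprime_X_sub_C_of_isUnit_sub (sub_ne_zero.2 hab).isUnit).pow
    · exact (isCoprime_X_sub_C_one_sub ha' hb').pow
    · exact (isCoprime_X_sub_C_one_sub hb' ha').symm.pow
    · exact (isCoprime_one_sub_one_sub hab).pow
  · intro a ha
    have ha' := norm_lt_one_of_mem_commonZeros ha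
    exact (isCoprime_X_sub_C_one_sub ha' ha').pow.mul_dvd (X_sub_C_pow_dvd a)
      (one_sub_C_mul_X_pow_dvd hp0 hp a)

lemma factorG_ne_zero : factorG N p ≠ 0 := by
  refine Finset.prod_ne_zero_iff.2 fun a _ => mul_ne_zero ?_ ?_
  · exact pow_ne_zero _ (X_sub_C_ne_zero a)
  · exact pow_ne_zero _ (one_sub_C_mul_X_ne_zero _)

lemma factorG_mul_factorR (hp0 : p ≠ 0) (hp : p.natDegree ≤ N) :
    factorG N p * factorR N p = p :=
  EuclideanDomain.mul_div_cancel' factorG_ne_zero (factorG_dvd hp0 hp)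

lemma natDegree_factor_le (a : ℂ) (j : ℕ) :
    ((X - C a) ^ j * (1 - C (starRingEnd ℂ a) * X) ^ j).natDegree ≤ 2 * j := by
  refine natDegree_mul_le.trans ?_
  have h1 := natDegree_pow_le_of_le j (natDegree_X_sub_C a).le
  have h2 := natDegree_pow_le_of_le j (natDegree_one_sub_C_mul_X_le (starRingEnd ℂ a))
  omega

lemma pstar_factor (a : ℂ) (j : ℕ) :
    pstar (2 * j) ((X - C a) ^ j * (1 - C (starRingEnd ℂ a) * X) ^ j) =
      (X - C a) ^ j * (1 - C (starRingEnd ℂ a) * X) ^ j := by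
  have h1 := pstar_pow (natDegree_X_sub_C a).le j
  have h2 := pstar_pow (natDegree_one_sub_C_mul_X_le (starRingEnd ℂ a)) j
  rw [one_mul] at h1 h2
  rw [two_mul, pstar_mul, h1, h2, pstar_X_sub_C, pstar_one_sub_C_mul_X, mul_comm]
  · simp
  · simpa using natDegree_pow_le_of_le j (natDegree_one_sub_C_mul_X_le (starRingEnd ℂ a))

lemma natDegree_factorG_le : (factorG N p).natDegree ≤ 2 * totalMult N p := by
  rw [totalMult, Finset.mul_sum]
  exact (natDegree_prod_le _ _).trans (Finset.sum_le_sum fun a _ => natDegree_factor_le a _)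

lemma pstar_factorG : pstar (2 * totalMult N p) (factorG N p) = factorG N p := by
  rw [totalMult, Finset.mul_sum, factorG, pstar_prod _ _ _ fun a _ => natDegree_factor_le a _]
  exact Finset.prod_congr rfl fun a _ => pstar_factor a _

lemma natDegree_factor (a : ℂ) (j : ℕ) :
    ((X - C a) ^ j * (1 - C (starRingEnd ℂ a) * X) ^ j).natDegree + (if a = 0 then j else 0) =
      2 * j := by
  rw [natDegree_mul (pow_ne_zero _ (X_sub_C_ne_zero a))
    (pow_ne_zero _ (one_sub_C_mul_X_ne_zero _)), natDegree_pow, natDegree_pow, natDegree_X_sub_C]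
  split_ifs with h
  · simp [h]; ring
  · have : (1 - C (starRingEnd ℂ a) * X).natDegree = 1 := by
      have h' : starRingEnd ℂ a ≠ 0 := by simpa using h
      compute_degree!
    rw [this]; ring

lemma natDegree_factorG :
    (factorG N p).natDegree +
      (∑ a ∈ commonZeros N p, if a = 0 then commonMult N p a else 0) = 2 * totalMult N p := by
  rw [factorG, natDegree_prod, ← Finset.sum_add_distrib, totalMult, Finset.mul_sum]
  · exact Finset.sum_congr rfl fun a _ => natDegree_factor a _
  · exact fun a _ => mul_ne_zero (pow_ne_zero _ (X_sub_C_ne_zero a))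
      (pow_ne_zero _ (one_sub_C_mul_X_ne_zero _))

/-- A zero of `p*` at the origin means that the top coefficients of `p`, counted up to degree `N`,
vanish. -/
lemma natDegree_add_commonMult_zero_le (hp0 : p ≠ 0) (hp : p.natDegree ≤ N) :
    p.natDegree + commonMult N p 0 ≤ N := by
  have hd := X_sub_C_pow_dvd_pstar (N := N) (p := p) 0
  rw [C_0, sub_zero, X_pow_dvd_iff] at hd
  by_contra! hlt
  have h := hd (N - p.natDegree) (by omega)
  rw [coeff_pstar _ (by omega), Nat.sub_sub_self hp] at h
  simp [hp0] at h

lemma factorR_ne_zero (hp0 : p ≠ 0) (hp : p.natDegree ≤ N) : factorR N p ≠ 0 := by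
  intro h
  have := factorG_mul_factorR hp0 hp
  rw [h, mul_zero] at this
  exact hp0 this.symm

/-- A common zero at the origin lowers the degree of `G` below `2m` by its multiplicity, but lowers
the bound on the degree of `p` by at least as much. -/
lemma natDegree_factorR_le (hp0 : p ≠ 0) (hp : p.natDegree ≤ N) :
    (factorR N p).natDegree + 2 * totalMult N p ≤ N := by
  have h1 := natDegree_mul (factorG_ne_zero (N := N) (p := p)) (factorR_ne_zero hp0 hp)
  rw [factorG_mul_factorR hp0 hp] at h1
  have h2 := natDegree_factorG (N := N) (p := p)
  have h3 := natDegree_add_commonMult_zero_le hp0 hp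
  have h4 : (∑ a ∈ commonZeros N p, if a = 0 then commonMult N p a else 0) ≤
      commonMult N p 0 := by
    rw [Finset.sum_ite_eq']
    split_ifs <;> simp
  omega

/-- The reflected polynomial factors as `p* = G R*`. -/
lemma factorG_mul_pstar_factorR (hp0 : p ≠ 0) (hp : p.natDegree ≤ N) :
    factorG N p * pstar (N - 2 * totalMult N p) (factorR N p) = pstar N p := by
  have h := natDegree_factorR_le hp0 hp
  have h2 := pstar_mul (natDegree_factorG_le (N := N) (p := p))
    (show (factorR N p).natDegree ≤ N - 2 * totalMult N p by omega)
  rw [pstar_factorG, factorG_mul_factorR hp0 hp,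
    show 2 * totalMult N p + (N - 2 * totalMult N p) = N by omega] at h2
  exact h2.symm

/-- A further common zero would raise the common multiplicity at `a` above the minimum already
absorbed by `G`. -/
lemma eval_pstar_factorR_ne_zero_of_norm_lt_one (hp0 : p ≠ 0) (hp : p.natDegree ≤ N) {a : ℂ}
    (ha : ‖a‖ < 1) (h : (factorR N p).eval a = 0) :
    (pstar (N - 2 * totalMult N p) (factorR N p)).eval a ≠ 0 := by
  intro h'
  have e1 := factorG_mul_factorR hp0 hp
  have e2 := factorG_mul_pstar_factorR hp0 hp
  have hmem : a ∈ commonZeros N p := by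
    rw [mem_commonZeros hp0]
    refine ⟨?_, ?_, ha⟩
    · rw [← e1, eval_mul, h, mul_zero]
    · rw [← e2, eval_mul, h', mul_zero]
  have hG : (X - C a) ^ commonMult N p a ∣ factorG N p :=
    (dvd_mul_right _ _).trans (Finset.dvd_prod_of_mem _ hmem)
  have d1 : (X - C a) ^ (commonMult N p a + 1) ∣ p := by
    have := mul_dvd_mul hG (dvd_iff_isRoot.2 h)
    rwa [e1, ← pow_succ] at this
  have d2 : (X - C a) ^ (commonMult N p a + 1) ∣ pstar N p := by
    have := mul_dvd_mul hG (dvd_iff_isRoot.2 h')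
    rwa [e2, ← pow_succ] at this
  rw [← le_rootMultiplicity_iff hp0] at d1
  rw [← le_rootMultiplicity_iff (pstar_ne_zero hp0)] at d2
  have := le_min d1 d2
  unfold commonMult at this
  omega

/-- `R` and `R*` have no common zero off the unit circle. -/
lemma eval_pstar_factorR_ne_zero (hp0 : p ≠ 0) (hp : p.natDegree ≤ N) {a : ℂ}
    (ha : ‖a‖ ≠ 1) (h : (factorR N p).eval a = 0) :
    (pstar (N - 2 * totalMult N p) (factorR N p)).eval a ≠ 0 := by
  rcases lt_or_gt_of_ne ha with ha | ha
  · exact eval_pstar_factorR_ne_zero_of_norm_lt_one hp0 hp ha h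
  -- Outside the disc, pass to `1 / conj a`: reflection exchanges the zeros of `R` and `R*`.
  · intro h'
    have hd := natDegree_factorR_le hp0 hp
    have hd' : (factorR N p).natDegree ≤ N - 2 * totalMult N p := by omega
    have ha0 : a ≠ 0 := by rintro rfl; simp at ha; linarith
    have hb0 : (starRingEnd ℂ a)⁻¹ ≠ 0 := by simpa using ha0
    rw [eval_pstar hd' ha0] at h'
    have h1 : (factorR N p).eval (starRingEnd ℂ a)⁻¹ = 0 := by simpa [ha0] using h'
    refine eval_pstar_factorR_ne_zero_of_norm_lt_one hp0 hp ?_ h1 ?_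
    · rw [norm_inv, RCLike.norm_conj]; exact inv_lt_one_of_one_lt₀ ha
    · rw [eval_pstar hd' hb0]
      simp [h]

end factor

/-! ### Comparison of functions on the unit circle -/

lemma continuous_eval_norm (f : ℂ[X]) : Continuous fun z => ‖f.eval z‖ := by fun_prop

lemma circleIntegrable_of_continuous {f : ℂ → ℝ} (hf : Continuous f) :
    CircleIntegrable f 0 1 :=
  hf.continuousOn.circleIntegrable zero_le_one

/-- If `f ≤ g` are continuous and the circle average of `g` is at most that of `f`, then `f = g`
on the unit circle. -/
lemma eq_of_circleAverage_le {f g : ℂ → ℝ} (hf : Continuous f) (hg : Continuous g)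
    (hle : ∀ z, f z ≤ g z) (h : Real.circleAverage g 0 1 ≤ Real.circleAverage f 0 1) {z : ℂ}
    (hz : ‖z‖ = 1) : f z = g z := by
  by_contra hne
  have hlt : f z < g z := lt_of_le_of_ne (hle z) hne
  have hz' : z ∈ Metric.sphere (0 : ℂ) |1| := by simpa using hz
  rw [← image_circleMap_Ioc] at hz'
  obtain ⟨θ, hθ, rfl⟩ := hz'
  have key := intervalIntegral.integral_lt_integral_of_continuousOn_of_le_of_exists_lt
    Real.two_pi_pos (hf.comp (continuous_circleMap 0 1)).continuousOn
    (hg.comp (continuous_circleMap 0 1)).continuousOn (fun x _ => hle _)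
    ⟨θ, Set.Ioc_subset_Icc_self hθ, hlt⟩
  simp only [Real.circleAverage, smul_eq_mul] at h
  have hpi : 0 < (2 * Real.pi)⁻¹ := by positivity
  exact absurd (le_of_mul_le_mul_left h hpi) (not_le.2 key)

lemma infinite_unitCircle : {z : ℂ | ‖z‖ = 1}.Infinite := by
  have h : {z : ℂ | ‖z‖ = 1} = Metric.sphere 0 1 := by ext; simp
  rw [h]
  refine (isPreconnected_sphere (by simp [Complex.rank_real_complex]) _ _).infinite_of_nontrivial ?_
  exact ⟨1, by simp, -1, by simp, by norm_num⟩

lemma eq_of_eval_eq_on_unitCircle {f g : ℂ[X]} (h : ∀ z : ℂ, ‖z‖ = 1 → f.eval z = g.eval z) :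
    f = g :=
  eq_of_infinite_eval_eq f g (infinite_unitCircle.mono h)

/-- Approach `a` along the arc `a e^{it}`, `t → 0+`, which avoids `a` for `0 < t < π`. -/
lemma le_of_forall_ne_on_unitCircle {a : ℂ} (ha : ‖a‖ = 1) {φ ψ : ℂ → ℝ} (hφ : Continuous φ)
    (hψ : Continuous ψ) (h : ∀ z, ‖z‖ = 1 → z ≠ a → φ z ≤ ψ z) : φ a ≤ ψ a := by
  have hc : Continuous fun t : ℝ => a * Complex.exp (t * Complex.I) := by fun_prop
  have ht : Filter.Tendsto (fun t : ℝ => a * Complex.exp (t * Complex.I)) (nhdsWithin 0 (Set.Ioi 0))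
      (nhds a) := by
    have := (hc.tendsto 0).mono_left (nhdsWithin_le_nhds (s := Set.Ioi 0))
    simpa using this
  refine le_of_tendsto_of_tendsto ((hφ.tendsto a).comp ht) ((hψ.tendsto a).comp ht) ?_
  filter_upwards [Ioo_mem_nhdsGT Real.pi_pos] with t ht
  refine h _ (by simp [ha, Complex.norm_exp_ofReal_mul_I]) fun heq => ?_
  have ha0 : a ≠ 0 := by rintro rfl; simp at ha
  have h1 : Complex.exp (t * Complex.I) = 1 := mul_left_cancel₀ ha0 (heq.trans (mul_one a).symm)
  have h2 := congrArg Complex.im h1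
  rw [Complex.exp_ofReal_mul_I_im, Complex.one_im] at h2
  exact (Real.sin_pos_of_pos_of_lt_pi ht.1 ht.2).ne' h2

/-- A polynomial dominated by `g` on the unit circle inherits the zeros of `g` there. -/
lemma X_sub_C_pow_dvd_of_norm_le {K : ℝ} {a : ℂ} (ha : ‖a‖ = 1) (n : ℕ) {f g : ℂ[X]}
    (hfg : ∀ z, ‖z‖ = 1 → ‖f.eval z‖ ≤ K * ‖g.eval z‖) (h : (X - C a) ^ n ∣ g) :
    (X - C a) ^ n ∣ f := by
  induction n generalizing f g with
  | zero => simp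
  | succ n ih =>
    obtain ⟨u, rfl⟩ := h
    have hfa : f.eval a = 0 := by
      have := hfg a ha
      simpa using this
    obtain ⟨f₁, rfl⟩ := dvd_iff_isRoot.2 hfa
    rw [pow_succ', mul_assoc] at hfg
    rw [pow_succ']
    refine mul_dvd_mul_left _ (ih (g := (X - C a) ^ n * u) ?_ (dvd_mul_right _ _))
    -- Away from `a` the factor `|z - a|` cancels; continuity then restores the bound at `a`.
    have hne : ∀ z, ‖z‖ = 1 → z ≠ a →
        ‖f₁.eval z‖ ≤ K * ‖((X - C a) ^ n * u).eval z‖ := by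
      intro z hz hza
      have h1 := hfg z hz
      rw [eval_mul, eval_mul (p := X - C a), norm_mul, norm_mul, mul_left_comm] at h1
      refine le_of_mul_le_mul_left h1 ?_
      simpa [sub_eq_zero] using hza
    intro z hz
    by_cases hza : z = a
    · rw [hza]
      exact le_of_forall_ne_on_unitCircle ha (continuous_eval_norm _)
        (continuous_const.mul (continuous_eval_norm _)) hne
    · exact hne z hz hza

/-- Equality gives `Re (u conj v) = |u||v| = |u conj v|`, so `u conj v` is real, and `u conj (u +
v)` differs from it by `|u|²`. -/
lemma im_mul_conj_add_eq_zero {u v : ℂ} (h : ‖u + v‖ = ‖u‖ + ‖v‖) :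
    (u * starRingEnd ℂ (u + v)).im = 0 := by
  have h1 : ‖u + v‖ ^ 2 = (‖u‖ + ‖v‖) ^ 2 := by rw [h]
  have hu := Complex.sq_norm u
  have hv := Complex.sq_norm v
  rw [Complex.sq_norm, add_sq, hu, hv] at h1
  simp only [Complex.normSq_apply, Complex.add_re, Complex.add_im] at h1 hu hv
  have h2 : u.re * v.re + u.im * v.im = ‖u‖ * ‖v‖ := by linarith
  have h3 : (u.re * v.re + u.im * v.im) ^ 2 =
      (u.re * u.re + u.im * u.im) * (v.re * v.re + v.im * v.im) := by
    rw [h2, mul_pow, hu, hv]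
  have h4 : (u.im * v.re - u.re * v.im) ^ 2 = 0 := by linarith
  have h5 := pow_eq_zero_iff (two_ne_zero) |>.1 h4
  simp
  linarith

lemma natDegree_le_of_mem_polySpace {Λ : Finset ℕ} {N : ℕ} (hΛ : ∀ i ∈ Λ, i ≤ N) {f : ℂ[X]}
    (hf : f ∈ polySpace Λ) : f.natDegree ≤ N := by
  rw [natDegree_le_iff_coeff_eq_zero]
  intro n hn
  exact hf n fun h => absurd (hΛ n h) (by omega)

/-- If `q / p` is real on the unit circle, then `q p* = p q*`. -/
lemma mul_pstar_eq_of_im_eq_zero {N : ℕ} {p q : ℂ[X]} (hp : p.natDegree ≤ N)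
    (hq : q.natDegree ≤ N)
    (h : ∀ z : ℂ, ‖z‖ = 1 → (q.eval z * starRingEnd ℂ (p.eval z)).im = 0) :
    q * pstar N p = p * pstar N q := by
  refine eq_of_eval_eq_on_unitCircle fun z hz => ?_
  rw [eval_mul, eval_mul, eval_pstar_of_norm_eq_one hp hz, eval_pstar_of_norm_eq_one hq hz]
  have h1 := Complex.conj_eq_iff_im.2 (h z hz)
  rw [map_mul, Complex.conj_conj] at h1
  linear_combination (-z ^ N) * h1

/-! ### Polynomials with real quotient by `p` are multiples of `R` -/

section multiplier

variable {N : ℕ} {p : ℂ[X]}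

/-- Multiplicities are compared root by root: on the circle by domination, off it because `R*` does
not vanish at a zero of `R`. -/
lemma factorR_dvd (hp0 : p ≠ 0) (hp : p.natDegree ≤ N) {q : ℂ[X]}
    (hqp : q * pstar (N - 2 * totalMult N p) (factorR N p) = factorR N p * pstar N q) {K : ℝ}
    (hK : ∀ z, ‖z‖ = 1 → ‖q.eval z‖ ≤ K * ‖p.eval z‖) : factorR N p ∣ q := by
  by_cases hq0 : q = 0
  · simp [hq0]
  have hR0 := factorR_ne_zero hp0 hp
  rw [IsAlgClosed.dvd_iff_roots_le_roots hR0 hq0, Multiset.le_iff_count]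
  intro a
  rw [count_roots, count_roots, le_rootMultiplicity_iff hq0]
  have hd := pow_rootMultiplicity_dvd (factorR N p) a
  by_cases hRa : (factorR N p).eval a = 0
  · by_cases ha : ‖a‖ = 1
    · refine X_sub_C_pow_dvd_of_norm_le ha _ hK (hd.trans ?_)
      exact Dvd.intro_left _ (factorG_mul_factorR hp0 hp)
    · have hne := eval_pstar_factorR_ne_zero hp0 hp ha hRa
      have hcop : IsCoprime (X - C a) (pstar (N - 2 * totalMult N p) (factorR N p)) :=
        (irreducible_X_sub_C a).coprime_iff_not_dvd.2 fun h => hne (dvd_iff_isRoot.1 h)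
      refine hcop.pow_left.dvd_of_dvd_mul_right (hd.trans ?_)
      rw [hqp]
      exact dvd_mul_right _ _
  · rw [rootMultiplicity_eq_zero hRa]
    simp

lemma exists_eq_mul_factorR (hp0 : p ≠ 0) (hp : p.natDegree ≤ N) {q : ℂ[X]}
    (hq : q.natDegree ≤ N)
    (hreal : ∀ z : ℂ, ‖z‖ = 1 → (q.eval z * starRingEnd ℂ (p.eval z)).im = 0) {K : ℝ}
    (hK : ∀ z, ‖z‖ = 1 → ‖q.eval z‖ ≤ K * ‖p.eval z‖) :
    ∃ S : ℂ[X], S.natDegree ≤ 2 * totalMult N p ∧ pstar (2 * totalMult N p) S = S ∧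
      q = S * factorR N p := by
  have hG0 := factorG_ne_zero (N := N) (p := p)
  have hR0 := factorR_ne_zero hp0 hp
  have hRN := natDegree_factorR_le hp0 hp
  have e1 := factorG_mul_factorR hp0 hp
  have e2 := factorG_mul_pstar_factorR hp0 hp
  have hqp : q * pstar (N - 2 * totalMult N p) (factorR N p) = factorR N p * pstar N q := by
    have h := mul_pstar_eq_of_im_eq_zero hp hq hreal
    rw [← e2] at h
    apply mul_left_cancel₀ hG0
    rw [← mul_assoc _ (factorR N p), e1, ← h]
    ring
  obtain ⟨S, hS⟩ := factorR_dvd hp0 hp hqp hK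
  rw [mul_comm] at hS
  have hSR : S * pstar (N - 2 * totalMult N p) (factorR N p) = pstar N q := by
    apply mul_left_cancel₀ hR0
    rw [← hqp, hS]
    ring
  have hzero : (factorR N p).eval 0 = 0 →
      (pstar (N - 2 * totalMult N p) (factorR N p)).eval 0 ≠ 0 :=
    eval_pstar_factorR_ne_zero hp0 hp (by simp)
  generalize totalMult N p = m at *
  generalize factorR N p = R at *
  -- If `R` has degree `N - 2m`, compare degrees in `q = S R`. Otherwise `R*` vanishes at `0`, so
  -- `R` does not, `R*` has full degree, and `q* = S R*` gives the bound.
  have hdeg : S.natDegree ≤ 2 * m := by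
    by_cases hS0 : S = 0
    · simp [hS0]
    by_cases hcase : R.natDegree = N - 2 * m
    · have h := hq
      rw [hS, natDegree_mul hS0 hR0] at h
      omega
    · have hR'0 := pstar_ne_zero (n := N - 2 * m) hR0
      rw [← coeff_zero_eq_eval_zero, ← coeff_zero_eq_eval_zero, coeff_pstar _ (Nat.zero_le _),
        Nat.sub_zero, coeff_eq_zero_of_natDegree_lt (by omega : R.natDegree < N - 2 * m)] at hzero
      have hle : N - 2 * m ≤ (pstar (N - 2 * m) R).natDegree := by
        refine le_natDegree_of_ne_zero ?_
        rw [coeff_pstar _ le_rfl, Nat.sub_self]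
        intro h
        exact hzero (by simpa using h) (map_zero _)
      have h := natDegree_pstar_le hq
      rw [← hSR, natDegree_mul hS0 hR'0] at h
      omega
  refine ⟨S, hdeg, ?_, hS⟩
  have h := pstar_mul hdeg (show R.natDegree ≤ N - 2 * m by omega)
  rw [← hS, show 2 * m + (N - 2 * m) = N by omega, ← hSR] at h
  exact (mul_right_cancel₀ (pstar_ne_zero hR0) h).symm

end multiplier

/-! ### The norm under self-reciprocal perturbations -/

/-- On the unit circle `G(z) = z ^ m * |G(z)|`. -/
lemma eval_factorG {N : ℕ} {p : ℂ[X]} {z : ℂ} (hz : ‖z‖ = 1) :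
    (factorG N p).eval z = z ^ totalMult N p * (‖(factorG N p).eval z‖ : ℂ) := by
  rw [factorG, eval_prod, norm_prod, Complex.ofReal_prod, totalMult, ← Finset.prod_pow_eq_pow_sum,
    ← Finset.prod_mul_distrib]
  refine Finset.prod_congr rfl fun a _ => ?_
  have h1 : 1 - starRingEnd ℂ a * z = z * starRingEnd ℂ (z - a) := by
    have : z * starRingEnd ℂ z = 1 := by rw [Complex.mul_conj, Complex.normSq_eq_norm_sq, hz]; simp
    rw [map_sub, mul_sub, this]
    ring
  simp only [eval_mul, eval_pow, eval_sub, eval_X, eval_C, eval_one]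
  rw [h1, ← mul_pow, norm_pow, Complex.ofReal_pow, ← mul_pow]
  congr 1
  rw [norm_mul, norm_mul, hz, RCLike.norm_conj, one_mul, mul_left_comm, Complex.mul_conj,
    Complex.normSq_eq_norm_sq, pow_two]

lemma eval_factorG_ne_zero {N : ℕ} {p : ℂ[X]} {z : ℂ} (hz : ‖z‖ = 1) :
    (factorG N p).eval z ≠ 0 := by
  rw [factorG, eval_prod]
  refine Finset.prod_ne_zero_iff.2 fun a ha => ?_
  have ha := norm_lt_one_of_mem_commonZeros ha
  simp only [eval_mul, eval_pow, eval_sub, eval_X, eval_C, eval_one]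
  refine mul_ne_zero (pow_ne_zero _ ?_) (pow_ne_zero _ ?_)
  · rw [sub_ne_zero]
    rintro rfl
    linarith
  · intro h
    have h1 : ‖starRingEnd ℂ a * z‖ = 1 := by rw [← sub_eq_zero.1 h]; simp
    rw [norm_mul, RCLike.norm_conj, hz] at h1
    linarith

/-- The function `Re (S(z) / z ^ m)` on the unit circle. -/
noncomputable def realPart (m : ℕ) (S : ℂ[X]) (z : ℂ) : ℝ := (S.eval z * starRingEnd ℂ z ^ m).re

lemma continuous_realPart (m : ℕ) (S : ℂ[X]) : Continuous (realPart m S) := by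
  unfold realPart
  exact Complex.continuous_re.comp (S.continuous.mul (Complex.continuous_conj.pow m))

/-- Self-reciprocity makes `S(z) / z^m` equal to its conjugate on the circle, where `1 / z = conj
z`. -/
lemma eval_eq_realPart {m : ℕ} {S : ℂ[X]} (hS : S.natDegree ≤ 2 * m)
    (hS' : pstar (2 * m) S = S) {z : ℂ} (hz : ‖z‖ = 1) :
    S.eval z = z ^ m * (realPart m S z : ℂ) := by
  have h := eval_pstar_of_norm_eq_one hS hz
  rw [hS'] at h
  have hzz : z ^ m * starRingEnd ℂ z ^ m = 1 := by
    rw [← mul_pow, Complex.mul_conj, Complex.normSq_eq_norm_sq, hz]; simp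
  have hre : starRingEnd ℂ (S.eval z * starRingEnd ℂ z ^ m) = S.eval z * starRingEnd ℂ z ^ m := by
    rw [map_mul, map_pow, Complex.conj_conj]
    calc _ = z ^ (2 * m) * starRingEnd ℂ (S.eval z) * starRingEnd ℂ z ^ m := by
          rw [two_mul, pow_add]
          linear_combination (-starRingEnd ℂ (S.eval z) * z ^ m) * hzz
      _ = _ := by rw [← h]
  rw [realPart, Complex.conj_eq_iff_re.1 hre]
  linear_combination (-S.eval z) * hzz

lemma abs_realPart_le (m : ℕ) (S : ℂ[X]) {z : ℂ} (hz : ‖z‖ = 1) :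
    |realPart m S z| ≤ ‖S.eval z‖ := by
  refine (Complex.abs_re_le_norm _).trans ?_
  rw [norm_mul, norm_pow, RCLike.norm_conj, hz, one_pow, mul_one]

/-- On the circle `G + εS = z^m (|G| + ε Re (S / z^m))`. The bound on `ε` keeps the bracket
nonnegative, so its modulus is affine in `ε`. -/
lemma l1Norm_perturb {N : ℕ} {p R S : ℂ[X]} (hS : S.natDegree ≤ 2 * totalMult N p)
    (hS' : pstar (2 * totalMult N p) S = S) {ε : ℝ}
    (hε : ∀ z, ‖z‖ = 1 → |ε| * ‖S.eval z‖ ≤ ‖(factorG N p).eval z‖) :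
    l1Norm ((factorG N p + ε • S) * R) = l1Norm (factorG N p * R) +
      ε * Real.circleAverage (fun z => ‖R.eval z‖ * realPart (totalMult N p) S z) 0 1 := by
  have hc : Continuous fun z => ‖R.eval z‖ * realPart (totalMult N p) S z :=
    (continuous_eval_norm R).mul (continuous_realPart _ _)
  have hc' : Continuous fun z => ε • (‖R.eval z‖ * realPart (totalMult N p) S z) :=
    continuous_const.mul hc
  unfold l1Norm
  rw [← smul_eq_mul ε, ← Real.circleAverage_fun_smul, ← Real.circleAverage_fun_add
    (circleIntegrable_of_continuous (continuous_eval_norm _))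
    (circleIntegrable_of_continuous hc')]
  refine Real.circleAverage_congr_sphere fun z hz => ?_
  have hz : ‖z‖ = 1 := by simpa using hz
  have hG := eval_factorG (N := N) (p := p) hz
  have hSz := eval_eq_realPart hS hS' hz
  have hnn : 0 ≤ ‖(factorG N p).eval z‖ + ε * realPart (totalMult N p) S z := by
    have h1 := abs_realPart_le (totalMult N p) S hz
    have h2 : |ε * realPart (totalMult N p) S z| ≤ ‖(factorG N p).eval z‖ := by
      rw [abs_mul]
      exact (mul_le_mul_of_nonneg_left h1 (abs_nonneg _)).trans (hε z hz)
    linarith [(abs_le.1 h2).1]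
  have hsum : (factorG N p + ε • S).eval z = z ^ totalMult N p *
      ((‖(factorG N p).eval z‖ + ε * realPart (totalMult N p) S z : ℝ) : ℂ) := by
    rw [eval_add, eval_smul, Complex.real_smul, hSz]
    nth_rewrite 1 [hG]
    push_cast
    ring
  simp only [eval_mul, norm_mul, smul_eq_mul]
  rw [hsum, norm_mul, norm_pow, hz, one_pow, one_mul, Complex.norm_real, Real.norm_eq_abs,
    abs_of_nonneg hnn]
  ring

/-! ### Extremality in terms of multipliers of `R` -/

lemma l1Norm_smul (c : ℝ) (f : ℂ[X]) : l1Norm (c • f) = |c| * l1Norm f := by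
  unfold l1Norm
  rw [← smul_eq_mul, ← Real.circleAverage_fun_smul]
  simp [eval_smul]

lemma ne_zero_of_l1Norm_eq_one {p : ℂ[X]} (h : l1Norm p = 1) : p ≠ 0 := by
  rintro rfl
  have h0 := l1Norm_smul 0 0
  rw [smul_zero, abs_zero, zero_mul] at h0
  linarith

lemma real_smul_mem_polySpace {Λ : Finset ℕ} {f : ℂ[X]} (hf : f ∈ polySpace Λ) (c : ℝ) :
    c • f ∈ polySpace Λ := by
  intro i hi
  rw [coeff_smul, hf i hi, smul_zero]

lemma pstar_add (n : ℕ) (f g : ℂ[X]) : pstar n (f + g) = pstar n f + pstar n g := by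
  simp [pstar]

lemma pstar_real_smul (n : ℕ) (c : ℝ) (f : ℂ[X]) : pstar n (c • f) = c • pstar n f := by
  ext i
  simp [pstar, coeff_reflect]

/-- A nonzero perturbation with vanishing mean destroys extremality. -/
lemma eq_zero_of_mem_extremePoints {Λ : Finset ℕ} {N : ℕ} {p S : ℂ[X]}
    (hΛ : ∀ i ∈ Λ, i ≤ N) (hnorm : l1Norm p = 1)
    (hext : p ∈ Set.extremePoints ℝ (ball Λ)) (hS : S.natDegree ≤ 2 * totalMult N p)
    (hS' : pstar (2 * totalMult N p) S = S) (hSR : S * factorR N p ∈ polySpace Λ)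
    (hmean : Real.circleAverage
      (fun z => ‖(factorR N p).eval z‖ * realPart (totalMult N p) S z) 0 1 = 0) : S = 0 := by
  have hp0 := ne_zero_of_l1Norm_eq_one hnorm
  have hpΛ : p ∈ polySpace Λ := hext.1.1
  have hp := natDegree_le_of_mem_polySpace hΛ hpΛ
  have e1 := factorG_mul_factorR hp0 hp
  obtain ⟨ε, hε0, hε⟩ : ∃ ε : ℝ, 0 < ε ∧
      ∀ z, ‖z‖ = 1 → ε * ‖S.eval z‖ ≤ ‖(factorG N p).eval z‖ := by
    have hcomp := isCompact_sphere (0 : ℂ) 1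
    have hne : (Metric.sphere (0 : ℂ) 1).Nonempty := ⟨1, by simp⟩
    obtain ⟨z₀, hz₀, hmin⟩ := hcomp.exists_isMinOn hne
      (continuous_eval_norm (factorG N p)).continuousOn
    obtain ⟨z₁, hz₁, hmax⟩ := hcomp.exists_isMaxOn hne (continuous_eval_norm S).continuousOn
    have hpos : 0 < ‖(factorG N p).eval z₀‖ :=
      norm_pos_iff.2 (eval_factorG_ne_zero (by simpa using hz₀))
    -- The minimum of `|G|` over the maximum of `|S|`; the `+ 1` keeps the denominator positive when
    -- `S` vanishes.
    refine ⟨‖(factorG N p).eval z₀‖ / (‖S.eval z₁‖ + 1), by positivity, fun z hz => ?_⟩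
    have hz : z ∈ Metric.sphere (0 : ℂ) 1 := by simpa using hz
    have h1 : ‖S.eval z‖ ≤ ‖S.eval z₁‖ := hmax hz
    have h2 : ‖(factorG N p).eval z₀‖ ≤ ‖(factorG N p).eval z‖ := hmin hz
    refine le_trans ?_ h2
    rw [div_mul_eq_mul_div, div_le_iff₀ (by positivity)]
    exact mul_le_mul_of_nonneg_left (by linarith) hpos.le
  have hmem : ∀ δ : ℝ, |δ| = ε → p + δ • (S * factorR N p) ∈ ball Λ := by
    intro δ hδ
    refine ⟨add_mem hpΛ (real_smul_mem_polySpace hSR δ), ?_⟩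
    have h := l1Norm_perturb (R := factorR N p) hS hS' (ε := δ) (by rwa [hδ])
    rw [hmean, mul_zero, add_zero, add_mul, e1, hnorm, smul_mul_assoc] at h
    exact h.le
  have hfix := (mem_extremePoints_iff_left.1 hext).2 _ (hmem ε (abs_of_pos hε0)) _
    (hmem (-ε) (by rw [abs_neg, abs_of_pos hε0]))
    ⟨1 / 2, 1 / 2, by norm_num, by norm_num, by norm_num, by
      rw [← smul_add, neg_smul, add_add_add_comm, add_neg_cancel, add_zero, ← two_smul ℝ p,
        smul_smul]
      norm_num⟩
  have h0 : ε • (S * factorR N p) = 0 := by simpa using hfix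
  rcases smul_eq_zero.1 h0 with h | h
  · exact absurd h hε0.ne'
  · exact (mul_eq_zero.1 h).resolve_right (factorR_ne_zero hp0 hp)

/-- Extremality of `p` means that every self-reciprocal multiplier of `R` that preserves
`polySpace Λ` is a real multiple of `G`. -/
theorem mem_extremePoints_iff_forall_eq_smul {Λ : Finset ℕ} {N : ℕ} {p : ℂ[X]}
    (hΛ : ∀ i ∈ Λ, i ≤ N) (hpΛ : p ∈ polySpace Λ) (hnorm : l1Norm p = 1) :
    p ∈ Set.extremePoints ℝ (ball Λ) ↔
      ∀ S : ℂ[X], S.natDegree ≤ 2 * totalMult N p → pstar (2 * totalMult N p) S = S →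
        S * factorR N p ∈ polySpace Λ → ∃ c : ℝ, S = c • factorG N p := by
  have hp0 := ne_zero_of_l1Norm_eq_one hnorm
  have hp := natDegree_le_of_mem_polySpace hΛ hpΛ
  have e1 := factorG_mul_factorR hp0 hp
  constructor
  · intro hext S hS hS' hSR
    set m := totalMult N p with hm
    set R := factorR N p with hR
    -- The weighted mean of `G` is the norm of `p`, namely `1`, so `S - tG` has mean zero.
    set t := Real.circleAverage (fun z => ‖R.eval z‖ * realPart m S z) 0 1 with ht
    refine ⟨t, ?_⟩
    have hc : ∀ T : ℂ[X], CircleIntegrable (fun z => ‖R.eval z‖ * realPart m T z) 0 1 := fun T =>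
      circleIntegrable_of_continuous ((continuous_eval_norm R).mul (continuous_realPart _ _))
    have hone : Real.circleAverage (fun z => ‖R.eval z‖ * realPart m (factorG N p) z) 0 1 = 1 := by
      refine (Real.circleAverage_congr_sphere (f₂ := fun z => ‖p.eval z‖) fun z hz => ?_).trans hnorm
      have hz : ‖z‖ = 1 := by simpa using hz
      have hz0 : z ^ m ≠ 0 := pow_ne_zero _ (by rintro rfl; simp at hz)
      have h1 := eval_factorG (N := N) (p := p) hz
      have h2 := eval_eq_realPart natDegree_factorG_le (pstar_factorG (N := N) (p := p)) hz
      have h3 := mul_left_cancel₀ hz0 (h1.symm.trans h2)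
      have h4 := Complex.ofReal_injective h3
      have h5 : p.eval z = (factorG N p).eval z * R.eval z := by rw [← eval_mul, e1]
      simp only [h5, norm_mul]
      rw [h4, mul_comm]
    have hmean : Real.circleAverage
        (fun z => ‖R.eval z‖ * realPart m (S + (-t) • factorG N p) z) 0 1 = 0 := by
      have hsplit : (fun z => ‖R.eval z‖ * realPart m (S + (-t) • factorG N p) z) =
          fun z => ‖R.eval z‖ * realPart m S z +
            (-t) • (‖R.eval z‖ * realPart m (factorG N p) z) := by
        funext z
        simp only [realPart, eval_add, eval_smul, add_mul, Complex.add_re, smul_mul_assoc,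
          Complex.smul_re, smul_eq_mul]
        ring
      have hcG : CircleIntegrable
          (fun z => (-t) • (‖R.eval z‖ * realPart m (factorG N p) z)) 0 1 :=
        circleIntegrable_of_continuous (continuous_const.mul
          ((continuous_eval_norm R).mul (continuous_realPart _ _)))
      rw [hsplit, Real.circleAverage_fun_add (hc S) hcG,
        Real.circleAverage_fun_smul, hone, ← ht]
      simp
    have hz := eq_zero_of_mem_extremePoints (N := N) hΛ hnorm hext
      (natDegree_add_le_of_degree_le hS ((natDegree_smul_le _ _).trans natDegree_factorG_le))
      (by rw [pstar_add, pstar_real_smul, hS', pstar_factorG])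
      (by rw [add_mul, smul_mul_assoc, e1]; exact add_mem hSR (real_smul_mem_polySpace hpΛ _))
      hmean
    rw [neg_smul] at hz
    exact add_neg_eq_zero.1 hz
  · intro H
    rw [mem_extremePoints_iff_left]
    refine ⟨⟨hpΛ, hnorm.le⟩, ?_⟩
    rintro x₁ hx₁ x₂ hx₂ ⟨a, b, ha, hb, hab, hsum⟩
    have hev : ∀ z, p.eval z = a • x₁.eval z + b • x₂.eval z := by
      intro z
      rw [← hsum, eval_add, eval_smul, eval_smul]
    -- The right side averages to at most `a + b = 1`, the average of the left side, so the triangle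
    -- inequality is an equality pointwise.
    have heq : ∀ z, ‖z‖ = 1 → ‖p.eval z‖ = ‖a • x₁.eval z‖ + ‖b • x₂.eval z‖ := by
      intro z hz
      refine eq_of_circleAverage_le (f := fun z => ‖p.eval z‖)
        (g := fun z => ‖a • x₁.eval z‖ + ‖b • x₂.eval z‖) (by fun_prop) (by fun_prop)
        (fun z => ?_) ?_ hz
      · rw [hev]
        exact norm_add_le _ _
      · rw [Real.circleAverage_fun_add (circleIntegrable_of_continuous (by fun_prop))
          (circleIntegrable_of_continuous (by fun_prop))]
        have h1 : Real.circleAverage (fun z => ‖a • x₁.eval z‖) 0 1 = a * l1Norm x₁ := by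
          rw [← abs_of_pos ha, ← l1Norm_smul, abs_of_pos ha]
          simp [l1Norm, eval_smul]
        have h2 : Real.circleAverage (fun z => ‖b • x₂.eval z‖) 0 1 = b * l1Norm x₂ := by
          rw [← abs_of_pos hb, ← l1Norm_smul, abs_of_pos hb]
          simp [l1Norm, eval_smul]
        have h3 : Real.circleAverage (fun z => ‖p.eval z‖) 0 1 = 1 := hnorm
        rw [h1, h2, h3]
        nlinarith [hx₁.2, hx₂.2]
    obtain ⟨S, hS, hS', hxS⟩ := exists_eq_mul_factorR hp0 hp (q := x₁)
      (natDegree_le_of_mem_polySpace hΛ hx₁.1)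
      (fun z hz => by
        have h1 := heq z hz
        rw [hev] at h1
        have h2 := im_mul_conj_add_eq_zero h1
        rw [← hev, smul_mul_assoc, Complex.smul_im, smul_eq_mul] at h2
        exact (mul_eq_zero.1 h2).resolve_left ha.ne')
      (K := a⁻¹)
      (fun z hz => by
        have h1 := heq z hz
        rw [norm_smul, Real.norm_of_nonneg ha.le] at h1
        rw [inv_mul_eq_div, le_div_iff₀ ha, h1, mul_comm]
        linarith [norm_nonneg (b • x₂.eval z)])
    obtain ⟨c, rfl⟩ := H S hS hS' (hxS ▸ hx₁.1)
    rw [smul_mul_assoc, e1] at hxS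
    have hc : c ≤ 1 := by
      have h := hx₁.2
      rw [hxS, l1Norm_smul, hnorm, mul_one] at h
      exact (abs_le.1 h).2
    -- The other endpoint satisfies `b x₂ = (1 - ac) p`, whence `1 - ac ≤ b = 1 - a`.
    have hc' : 1 ≤ c := by
      have h : b • x₂ = (1 - a * c) • p := by
        rw [sub_smul, one_smul, mul_smul, ← hxS]
        nth_rewrite 1 [← hsum]
        simp
      have h2 := congrArg l1Norm h
      rw [l1Norm_smul, l1Norm_smul, hnorm, mul_one, abs_of_pos hb] at h2
      have h3 := le_abs_self (1 - a * c)
      have h4 := hx₂.2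
      have h5 : 1 - a * c ≤ b := by nlinarith
      nlinarith
    rw [hxS, le_antisymm hc hc', one_smul]

/-! ### Real coordinates for self-reciprocal polynomials -/

/-- The self-reciprocal polynomial of degree at most `2 * m` with real coordinates `v`. -/
noncomputable def selfReciprocal (m : ℕ) : (Fin (m + 1) ⊕ Fin m → ℝ) →ₗ[ℝ] ℂ[X] where
  toFun v := (∑ l : Fin (m + 1), v (.inl l) • (X ^ (m - l : ℕ) + X ^ (m + l : ℕ))) +
    ∑ i : Fin m, v (.inr i) • (C Complex.I * (X ^ (m + (i + 1) : ℕ) - X ^ (m - (i + 1) : ℕ)))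
  map_add' v w := by
    simp only [Pi.add_apply, add_smul, Finset.sum_add_distrib]
    abel
  map_smul' c v := by
    simp only [Pi.smul_apply, smul_eq_mul, mul_smul, Finset.smul_sum, smul_add, RingHom.id_apply]

lemma selfReciprocal_apply (m : ℕ) (v : Fin (m + 1) ⊕ Fin m → ℝ) :
    selfReciprocal m v =
      (∑ l : Fin (m + 1), v (.inl l) • (X ^ (m - l : ℕ) + X ^ (m + l : ℕ))) +
      ∑ i : Fin m, v (.inr i) •
        (C Complex.I * (X ^ (m + (i + 1) : ℕ) - X ^ (m - (i + 1) : ℕ))) := rfl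

lemma coeff_selfReciprocal (m : ℕ) (v : Fin (m + 1) ⊕ Fin m → ℝ) (n : ℕ) :
    (selfReciprocal m v).coeff n =
      (∑ l : Fin (m + 1), (v (.inl l) : ℂ) *
        ((if n = m - l then 1 else 0) + if n = m + l then 1 else 0)) +
      ∑ i : Fin m, (v (.inr i) : ℂ) *
        (Complex.I * ((if n = m + (i + 1) then 1 else 0) - if n = m - (i + 1) then 1 else 0)) := by
  simp [selfReciprocal_apply, coeff_X_pow, mul_add]

lemma natDegree_selfReciprocal_le (m : ℕ) (v : Fin (m + 1) ⊕ Fin m → ℝ) :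
    (selfReciprocal m v).natDegree ≤ 2 * m := by
  rw [natDegree_le_iff_coeff_eq_zero]
  intro n hn
  rw [coeff_selfReciprocal, Finset.sum_eq_zero, Finset.sum_eq_zero, add_zero]
  · intro i _
    rw [if_neg (by omega), if_neg (by omega)]
    simp
  · intro l _
    rw [if_neg (by omega), if_neg (by omega)]
    simp

lemma pstar_selfReciprocal (m : ℕ) (v : Fin (m + 1) ⊕ Fin m → ℝ) :
    pstar (2 * m) (selfReciprocal m v) = selfReciprocal m v := by
  ext n
  by_cases hn : n ≤ 2 * m
  · rw [coeff_pstar _ hn, coeff_selfReciprocal, coeff_selfReciprocal, map_add, map_sum, map_sum]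
    congr 1
    · refine Finset.sum_congr rfl fun l _ => ?_
      have h1 : (2 * m - n = m - l) = (n = m + l) := by grind
      have h2 : (2 * m - n = m + l) = (n = m - l) := by grind
      simp only [h1, h2]
      split_ifs <;> simp
    · refine Finset.sum_congr rfl fun i _ => ?_
      have h1 : (2 * m - n = m - (i + 1)) = (n = m + (i + 1)) := by grind
      have h2 : (2 * m - n = m + (i + 1)) = (n = m - (i + 1)) := by grind
      simp only [h1, h2]
      split_ifs <;> simp
  · have h := natDegree_selfReciprocal_le m v
    rw [coeff_eq_zero_of_natDegree_lt (h.trans_lt (by omega)),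
      coeff_eq_zero_of_natDegree_lt ((natDegree_pstar_le h).trans_lt (by omega))]

lemma coeff_selfReciprocal_mid (m : ℕ) (v : Fin (m + 1) ⊕ Fin m → ℝ) :
    (selfReciprocal m v).coeff m = 2 * (v (.inl 0) : ℂ) := by
  rw [coeff_selfReciprocal, Finset.sum_eq_single 0, Finset.sum_eq_zero, add_zero]
  · simp; ring
  · intro i _
    rw [if_neg (by omega), if_neg (by omega)]
    simp
  · intro l _ hl
    have : (l : ℕ) ≠ 0 := fun h => hl (Fin.ext h)
    rw [if_neg (by omega), if_neg (by omega)]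
    simp
  · simp

lemma coeff_selfReciprocal_add (m : ℕ) (v : Fin (m + 1) ⊕ Fin m → ℝ) (i : Fin m) :
    (selfReciprocal m v).coeff (m + (i + 1)) =
      (v (.inl i.succ) : ℂ) + (v (.inr i) : ℂ) * Complex.I := by
  rw [coeff_selfReciprocal, Finset.sum_eq_single i.succ, Finset.sum_eq_single i]
  · rw [if_neg (by omega), if_pos (by simp), if_pos rfl, if_neg (by omega)]
    simp
  · intro j _ hj
    have : (j : ℕ) ≠ i := fun h => hj (Fin.ext h)
    rw [if_neg (by omega), if_neg (by omega)]
    simp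
  · simp
  · intro l _ hl
    have : (l : ℕ) ≠ i + 1 := fun h => hl (Fin.ext (by simpa using h))
    rw [if_neg (by omega), if_neg (by omega)]
    simp
  · simp

lemma selfReciprocal_injective (m : ℕ) : Function.Injective (selfReciprocal m) := by
  rw [injective_iff_map_eq_zero]
  intro v hv
  have h0 := coeff_selfReciprocal_mid m v
  have h1 := coeff_selfReciprocal_add m v
  simp only [hv, coeff_zero] at h0 h1
  funext x
  rcases x with l | i
  · refine Fin.cases ?_ (fun i => ?_) l
    · simpa using h0.symm
    · simpa using (congrArg Complex.re (h1 i)).symm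
  · simpa using (congrArg Complex.im (h1 i)).symm

/-- The coefficients from `m` up to `2m` determine the rest by symmetry, and the middle one is real.
It is halved in the witness because the `l = 0` summand is `2 X^m`. -/
lemma exists_selfReciprocal_eq {m : ℕ} {S : ℂ[X]} (hS : S.natDegree ≤ 2 * m)
    (hS' : pstar (2 * m) S = S) : ∃ v, selfReciprocal m v = S := by
  have hsymm : ∀ {T : ℂ[X]}, pstar (2 * m) T = T → ∀ n ≤ 2 * m,
      T.coeff n = starRingEnd ℂ (T.coeff (2 * m - n)) := by
    intro T hT n hn
    conv_lhs => rw [← hT]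
    exact coeff_pstar T hn
  refine ⟨Sum.elim (Fin.cases ((S.coeff m).re / 2) fun i => (S.coeff (m + (i + 1))).re)
    fun i => (S.coeff (m + (i + 1))).im, ?_⟩
  set v : Fin (m + 1) ⊕ Fin m → ℝ :=
    Sum.elim (Fin.cases ((S.coeff m).re / 2) fun i => (S.coeff (m + (i + 1))).re)
      fun i => (S.coeff (m + (i + 1))).im with hv
  have hupper : ∀ n, m ≤ n → n ≤ 2 * m → (selfReciprocal m v).coeff n = S.coeff n := by
    intro n h1 h2
    rcases h1.eq_or_lt with rfl | h1
    · rw [coeff_selfReciprocal_mid]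
      have h := hsymm hS' m h2
      rw [show 2 * m - m = m by omega] at h
      have h3 := Complex.conj_eq_iff_re.1 h.symm
      simp only [hv, Sum.elim_inl, Fin.cases_zero]
      push_cast
      rw [h3]
      ring
    · obtain ⟨i, rfl⟩ : ∃ i : Fin m, n = m + (i + 1) :=
        ⟨⟨n - m - 1, by omega⟩, by simp only []; omega⟩
      rw [coeff_selfReciprocal_add]
      simp only [hv, Sum.elim_inl, Sum.elim_inr, Fin.cases_succ]
      exact Complex.re_add_im _
  ext n
  by_cases h2 : n ≤ 2 * m
  · by_cases h1 : m ≤ n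
    · exact hupper n h1 h2
    · rw [hsymm hS' n h2, hsymm (pstar_selfReciprocal m v) n h2,
        hupper (2 * m - n) (by omega) (by omega)]
  · rw [coeff_eq_zero_of_natDegree_lt (by omega : S.natDegree < n), coeff_eq_zero_of_natDegree_lt
      ((natDegree_selfReciprocal_le m v).trans_lt (by omega))]

/-! ### The block matrix and its kernel -/

lemma coeff_X_pow_mul_eq_intCoeff (R : ℂ[X]) (a n : ℕ) :
    (X ^ a * R).coeff n = intCoeff R ((n : ℤ) - a) := by
  rw [coeff_X_pow_mul', intCoeff]
  by_cases h : a ≤ n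
  · rw [if_pos h, if_pos (by omega)]
    congr 1
    omega
  · rw [if_neg h, if_neg (by omega)]

lemma coeff_selfReciprocal_mul (R : ℂ[X]) (m : ℕ) (v : Fin (m + 1) ⊕ Fin m → ℝ) (n : ℕ) :
    (selfReciprocal m v * R).coeff n =
      (∑ l : Fin (m + 1), (v (.inl l) : ℂ) *
        (intCoeff R ((n : ℤ) + (l : ℕ) - m) + intCoeff R ((n : ℤ) - (l : ℕ) - m))) +
      ∑ i : Fin m, (v (.inr i) : ℂ) * (Complex.I *
        (intCoeff R ((n : ℤ) - ((i : ℕ) + 1) - m) -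
          intCoeff R ((n : ℤ) + ((i : ℕ) + 1) - m))) := by
  rw [selfReciprocal_apply, add_mul, Finset.sum_mul, Finset.sum_mul, coeff_add, finsetSum_coeff,
    finsetSum_coeff]
  congr 1
  · refine Finset.sum_congr rfl fun l _ => ?_
    rw [smul_mul_assoc, coeff_smul, add_mul, coeff_add, coeff_X_pow_mul_eq_intCoeff,
      coeff_X_pow_mul_eq_intCoeff, Complex.real_smul]
    congr 3 <;> omega
  · refine Finset.sum_congr rfl fun i _ => ?_
    rw [smul_mul_assoc, coeff_smul, mul_assoc, coeff_C_mul, sub_mul, coeff_sub,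
      coeff_X_pow_mul_eq_intCoeff, coeff_X_pow_mul_eq_intCoeff, Complex.real_smul]
    congr 4 <;> omega

/-- The factor `i` in the antisymmetric basis vectors turns real parts into imaginary ones up to
sign. This yields the block `B⁻` here and `-A⁻` in the imaginary rows. -/
lemma blockMatrix_mulVec_inl {N M : ℕ} (k : Fin M → ℕ) (p : ℂ[X])
    (v : Fin (totalMult N p + 1) ⊕ Fin (totalMult N p) → ℝ) (j : Fin M) :
    (blockMatrix N k p).mulVec v (.inl j) =
      ((selfReciprocal (totalMult N p) v * factorR N p).coeff (k j)).re := by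
  rw [coeff_selfReciprocal_mul, Matrix.mulVec, dotProduct, Fintype.sum_sum_type, Complex.add_re,
    Complex.re_sum, Complex.re_sum]
  congr 1
  · refine Finset.sum_congr rfl fun l _ => ?_
    simp [blockMatrix, matAPlus]
    ring
  · refine Finset.sum_congr rfl fun i _ => ?_
    simp [blockMatrix, matBMinus]
    ring

lemma blockMatrix_mulVec_inr {N M : ℕ} (k : Fin M → ℕ) (p : ℂ[X])
    (v : Fin (totalMult N p + 1) ⊕ Fin (totalMult N p) → ℝ) (j : Fin M) :
    (blockMatrix N k p).mulVec v (.inr j) =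
      ((selfReciprocal (totalMult N p) v * factorR N p).coeff (k j)).im := by
  rw [coeff_selfReciprocal_mul, Matrix.mulVec, dotProduct, Fintype.sum_sum_type, Complex.add_im,
    Complex.im_sum, Complex.im_sum]
  congr 1
  · refine Finset.sum_congr rfl fun l _ => ?_
    simp [blockMatrix, matBPlus]
    ring
  · refine Finset.sum_congr rfl fun i _ => ?_
    simp [blockMatrix, matAMinus]
    ring

lemma blockMatrix_mulVec_eq_zero_iff {N M : ℕ} (k : Fin M → ℕ) (p : ℂ[X])
    (v : Fin (totalMult N p + 1) ⊕ Fin (totalMult N p) → ℝ) :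
    (blockMatrix N k p).mulVec v = 0 ↔
      ∀ j, (selfReciprocal (totalMult N p) v * factorR N p).coeff (k j) = 0 := by
  constructor
  · intro h j
    apply Complex.ext
    · rw [← blockMatrix_mulVec_inl, h]; rfl
    · rw [← blockMatrix_mulVec_inr, h]; rfl
  · intro h
    funext x
    rcases x with j | j
    · rw [blockMatrix_mulVec_inl, h]; rfl
    · rw [blockMatrix_mulVec_inr, h]; rfl

lemma mem_polySpace_freqSet_iff {N M : ℕ} {k : Fin M → ℕ} {f : ℂ[X]} (hf : f.natDegree ≤ N) :
    f ∈ polySpace (freqSet N k) ↔ ∀ j, f.coeff (k j) = 0 := by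
  constructor
  · intro h j
    exact h _ (by simp [freqSet])
  · intro h i hi
    by_cases hi' : i ≤ N
    · have : i ∈ Finset.univ.image k := by
        by_contra hne
        exact hi (by simp only [freqSet, Finset.mem_sdiff, Finset.mem_range]; exact ⟨by omega, hne⟩)
      obtain ⟨j, _, rfl⟩ := Finset.mem_image.1 this
      exact h j
    · exact coeff_eq_zero_of_natDegree_lt (by omega)

/-- A matrix with a nonzero kernel vector `w` has corank one iff `w` spans its kernel. -/
lemma rank_eq_iff_ker_eq_span {ι κ : Type*} [Fintype ι] [Fintype κ] [DecidableEq κ]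
    (A : Matrix ι κ ℝ) {d : ℕ} (hd : Fintype.card κ = d + 1) {w : κ → ℝ} (hw0 : w ≠ 0)
    (hw : A.mulVec w = 0) :
    A.rank = d ↔ ∀ v, A.mulVec v = 0 → ∃ c : ℝ, c • w = v := by
  have h := A.mulVecLin.finrank_range_add_finrank_ker
  rw [Module.finrank_fintype_fun_eq_card, hd] at h
  have hwmem : w ∈ LinearMap.ker A.mulVecLin := hw
  have hne : (⟨w, hwmem⟩ : LinearMap.ker A.mulVecLin) ≠ 0 := fun h => hw0 (congrArg Subtype.val h)
  have h1 := finrank_eq_one_iff_of_nonzero' (K := ℝ) _ hne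
  rw [Matrix.rank]
  constructor
  · intro hr v hv
    obtain ⟨c, hc⟩ := h1.1 (by omega) ⟨v, hv⟩
    exact ⟨c, congrArg Subtype.val hc⟩
  · intro H
    have := h1.2 fun ⟨v, hv⟩ => by
      obtain ⟨c, hc⟩ := H v hv
      exact ⟨c, Subtype.ext hc⟩
    omega

end Lacunary

/-! ### The rank criterion -/

theorem theorem2p1 (N M : ℕ) (hN : 0 < N) (k : Fin M → ℕ) (hk : StrictMono k)
    (hk_pos : ∀ j, 0 < k j) (hk_lt : ∀ j, k j < N)
    (p : Polynomial ℂ) (hp : p ∈ Lacunary.polySpace (Lacunary.freqSet N k))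
    (hnorm : Lacunary.l1Norm p = 1) :
    p ∈ Set.extremePoints ℝ (Lacunary.ball (Lacunary.freqSet N k)) ↔
      (Lacunary.blockMatrix N k p).rank = 2 * Lacunary.totalMult N p := by
  open Lacunary in
  have hΛ : ∀ i ∈ freqSet N k, i ≤ N := by
    intro i hi
    simp only [freqSet, Finset.mem_sdiff, Finset.mem_range] at hi
    omega
  have hp0 := ne_zero_of_l1Norm_eq_one hnorm
  have hdeg := natDegree_le_of_mem_polySpace hΛ hp
  have hRdeg := natDegree_factorR_le hp0 hdeg
  have hmem : ∀ S : ℂ[X], S.natDegree ≤ 2 * totalMult N p →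
      (S * factorR N p ∈ polySpace (freqSet N k) ↔
        ∀ j, (S * factorR N p).coeff (k j) = 0) := fun S hS =>
    mem_polySpace_freqSet_iff (natDegree_mul_le.trans (by omega))
  -- The coordinates of `G` give the distinguished kernel vector, since `G R = p` has no coefficient
  -- at any `k_j`.
  obtain ⟨w, hw⟩ := exists_selfReciprocal_eq natDegree_factorG_le (pstar_factorG (N := N) (p := p))
  have hw0 : w ≠ 0 := by
    rintro rfl
    rw [map_zero] at hw
    exact factorG_ne_zero hw.symm
  have hwker : (blockMatrix N k p).mulVec w = 0 := by
    rw [blockMatrix_mulVec_eq_zero_iff, hw, ← hmem _ natDegree_factorG_le,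
      factorG_mul_factorR hp0 hdeg]
    exact hp
  rw [mem_extremePoints_iff_forall_eq_smul hΛ hp hnorm,
    rank_eq_iff_ker_eq_span _ (by simp; ring) hw0 hwker]
  constructor
  · intro H v hv
    obtain ⟨c, hc⟩ := H _ (natDegree_selfReciprocal_le _ v) (pstar_selfReciprocal _ v)
      ((hmem _ (natDegree_selfReciprocal_le _ v)).2 ((blockMatrix_mulVec_eq_zero_iff k p v).1 hv))
    refine ⟨c, selfReciprocal_injective _ ?_⟩
    rw [map_smul, hw, hc]
  · intro H S hS hS' hSR
    obtain ⟨v, rfl⟩ := exists_selfReciprocal_eq hS hS'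
    obtain ⟨c, hc⟩ := H v ((blockMatrix_mulVec_eq_zero_iff k p v).2 ((hmem _ hS).1 hSR))
    exact ⟨c, by rw [← hc, map_smul, hw]⟩
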